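/- Let $A$ be a unital $C^*$-algebra (over $\mathbb{C}$) and let $a\in A$. The socle $\operatorname{soc}(A)$ is the sum of all minimal left ideals of $A$ (equivalently, since $A$ is semiprime, of all minimal right ideals); it is a two-sided ideal. For $S\subseteq A$ put $\operatorname{Ran}(S)=\{x\in A: sx=0\text{ for all }s\in S\}$ and $\operatorname{Lan}(S)=\{x\in A: xs=0\text{ for all }s\in S\}$. Let $\varrho_l(a)$ be the length of $\operatorname{Ran}(Aa)$ as a right $A$-module, and $\varrho_r(a)$ the length of $\operatorname{Lan}(aA)$ as a left $A$-module (lengths take values in $\mathbb{N}_0\cup\{\infty\}$). Call $a$ Fredholm if its class in the ring $A/\operatorname{soc}(A)$ is invertible. (1) The following are equivalent: (i) $a$ is weak$^+$-Fredholm, i.e. the left $A$-module $A/Aa$ has finite length; (ii) $a$ is semi$^+$-Fredholm, i.e. the class of $a$ in $A/\operatorname{soc}(A)$ is left invertible; (iii) the left $A$-module $A/Aa$ is semisimple; (iv) $\varrho_l(a)<\infty$ and $Aa$ is closed in $A$. (2) The following are equivalent: (i) $a$ is weak$^-$-Fredholm, i.e. the right $A$-module $A/aA$ has finite length; (ii)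 $a$ is semi$^-$-Fredholm, i.e. the class of $a$ in $A/\operatorname{soc}(A)$ is right invertible; (iii) the right $A$-module $A/aA$ is semisimple; (iv) $\varrho_r(a)<\infty$ and $aA$ is closed in $A$. (3) $a$ is Fredholm if and only if the left $A$-module $A/Aa$ and the right $A$-module $A/aA$ both have finite length. -/

import Mathlib

namespace FredholmLength

open MulOpposite

section Ring

variable {A : Type*} [Ring A]

/-- The left annihilator `Lan(S) = {a | a s = 0 for all s ∈ S}`, a left ideal of `A`. -/
def leftAnn (S : Set A) : Submodule A A where
  carrier := {a | ∀ s ∈ S, a * s = 0}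
  zero_mem' := fun s _ => zero_mul s
  add_mem' := fun {a b} ha hb s hs => by rw [add_mul, ha s hs, hb s hs, add_zero]
  smul_mem' := fun c a ha s hs => by rw [smul_eq_mul, mul_assoc, ha s hs, mul_zero]

/-- The right annihilator `Ran(S) = {a | s a = 0 for all s ∈ S}`, a right ideal of `A`.
Right ideals of `A` are the submodules of `A` over the opposite ring, which acts on `A` by
multiplication from the right. -/
def rightAnn (S : Set A) : Submodule Aᵐᵒᵖ A where
  carrier := {a | ∀ s ∈ S, s * a = 0}
  zero_mem' := fun s _ => mul_zero s
  add_mem' := fun {a b} ha hb s hs => by rw [mul_add, ha s hs, hb s hs, add_zero]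
  smul_mem' := fun c a ha s hs => by
    rw [MulOpposite.smul_eq_mul_unop, ← mul_assoc, ha s hs, zero_mul]

/-- The principal left ideal `A a`. -/
def leftIdeal (a : A) : Submodule A A := Submodule.span A {a}

/-- The principal right ideal `a A`. -/
def rightIdeal (a : A) : Submodule Aᵐᵒᵖ A := Submodule.span Aᵐᵒᵖ {a}

theorem mem_leftIdeal {a x : A} : x ∈ leftIdeal a ↔ ∃ b : A, b * a = x :=
  Submodule.mem_span_singleton

theorem mem_rightIdeal {a x : A} : x ∈ rightIdeal a ↔ ∃ b : A, a * b = x :=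
  Submodule.mem_span_singleton.trans
    ⟨fun ⟨b, hb⟩ => ⟨unop b, hb⟩, fun ⟨b, hb⟩ => ⟨op b, hb⟩⟩

variable (A) in
/-- The socle of `A`: the sum of all minimal left ideals. It is a two-sided ideal, and in a
semiprime ring (in particular in a C*-algebra) it is also the sum of all minimal right ideals. -/
def socle : Ideal A := sSup {m : Ideal A | IsAtom m}

instance socle_isTwoSided : (socle A).IsTwoSided := by
  refine ⟨fun {y} x hy => ?_⟩
  let f : A →ₗ[A] A := LinearMap.toSpanSingleton A A x
  suffices h : socle A ≤ Submodule.comap f (socle A) from h hy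
  refine sSup_le fun m hm => ?_
  rw [← Submodule.map_le_iff_le_comap]
  have hm' : IsSimpleModule A m := isSimpleModule_iff_isAtom.mpr hm
  have hr : Submodule.map f m = LinearMap.range (f.domRestrict m) := by
    rw [LinearMap.domRestrict, LinearMap.range_comp, Submodule.range_subtype]
  rcases LinearMap.injective_or_eq_zero (f.domRestrict m) with h | h
  · refine le_sSup (show IsAtom (Submodule.map f m) from ?_)
    rw [hr, ← isSimpleModule_iff_isAtom]
    exact IsSimpleModule.congr (LinearEquiv.ofInjective _ h).symm
  · rw [hr, h, LinearMap.range_zero]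
    exact bot_le

/-- `ξ_l(a)`, the length of the left `A`-module `A / A a`. -/
noncomputable def xiL (a : A) : ℕ∞ := Module.length A (A ⧸ leftIdeal a)

/-- `ξ_r(a)`, the length of the right `A`-module `A / a A`. -/
noncomputable def xiR (a : A) : ℕ∞ := Module.length Aᵐᵒᵖ (A ⧸ rightIdeal a)

/-- `ϱ_l(a)`, the length of the right `A`-module `Ran(A a)`. -/
noncomputable def rhoL (a : A) : ℕ∞ := Module.length Aᵐᵒᵖ (rightAnn (leftIdeal a : Set A))

/-- `ϱ_r(a)`, the length of the left `A`-module `Lan(a A)`. -/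
noncomputable def rhoR (a : A) : ℕ∞ := Module.length A (leftAnn (rightIdeal a : Set A))

/-- `a` is weak⁺-Fredholm if `A / A a` has finite length. -/
def IsWeakPlusFredholm (a : A) : Prop := xiL a < ⊤

/-- `a` is weak⁻-Fredholm if `A / a A` has finite length. -/
def IsWeakMinusFredholm (a : A) : Prop := xiR a < ⊤

/-- `a` is weak-Fredholm if it is weak⁺-Fredholm and weak⁻-Fredholm. -/
def IsWeakFredholm (a : A) : Prop := IsWeakPlusFredholm a ∧ IsWeakMinusFredholm a

/-- `a` is semi⁺-Fredholm if its class is left invertible in `A / soc(A)`. -/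
def IsSemiPlusFredholm (a : A) : Prop :=
  ∃ b : A ⧸ socle A, b * Ideal.Quotient.mk (socle A) a = 1

/-- `a` is semi⁻-Fredholm if its class is right invertible in `A / soc(A)`. -/
def IsSemiMinusFredholm (a : A) : Prop :=
  ∃ b : A ⧸ socle A, Ideal.Quotient.mk (socle A) a * b = 1

/-- `a` is Fredholm if its class is invertible in `A / soc(A)`. -/
def IsFredholm (a : A) : Prop := IsUnit (Ideal.Quotient.mk (socle A) a)

end Ring

end FredholmLength

namespace FredholmLength

open MulOpposite Filter Topology

/-! ### Transport of module invariants along semilinear equivalences -/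

section SemilinearEquiv

variable {R S M N : Type*} [Ring R] [Ring S] [AddCommGroup M] [AddCommGroup N] [Module R M]
  [Module S N] {σ : R →+* S} {σ' : S →+* R} [RingHomInvPair σ σ'] [RingHomInvPair σ' σ]

/-! Everything passes through `HasKernelProjection`: a projection `p` with `a p = 0` and `b a = 1 -
p`. Then `A a = Lan(p)` is closed, `A / A a ≅ A p`, and `Ran(A a) = p A` is the image of `A p` under
the involution, so `xiL a = rhoL a`. If this length is finite, `p` lies in the socle
(`le_socle_of_isArtinian`) and `b` is a left inverse modulo it.

Such a `p` exists once `0` is not an accumulation point of the spectrum of `k = a* a`. That gap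
follows from a relation `k^β = y k^(2β) + z a` with `0 < β ≤ 1/4`, which forces `t^(2β) ≤ C (t^(4β)
+ t)` on the spectrum. If `A a` is closed, it contains `k^(1/4)`, so `y = 0` works; if `A / A a` has
finite length, the relation comes from a stabilizing chain generated by roots of `k`.

The right-handed statements follow by applying the involution. -/

theorem length_eq_of_semilinearEquiv (e : M ≃ₛₗ[σ] N) : Module.length R M = Module.length S N := by
  apply WithBot.coe_injective
  rw [Module.coe_length, Module.coe_length,
    Order.krullDim_eq_of_orderIso (Submodule.orderIsoMapComap e)]

theorem isSemisimpleModule_iff_of_semilinearEquiv (e : M ≃ₛₗ[σ] N) :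
    IsSemisimpleModule R M ↔ IsSemisimpleModule S N := by
  rw [isSemisimpleModule_iff, isSemisimpleModule_iff]
  exact (Submodule.orderIsoMapComap e).complementedLattice_iff

end SemilinearEquiv

/-! ### The involution exchanges left and right -/

section StarRing

variable {A : Type*} [Ring A] [StarRing A]

instance : RingHomInvPair ((starRingEquiv : A ≃+* Aᵐᵒᵖ) : A →+* Aᵐᵒᵖ)
    ((starRingEquiv : A ≃+* Aᵐᵒᵖ).symm : Aᵐᵒᵖ →+* A) :=
  RingHomInvPair.of_ringEquiv _

instance : RingHomInvPair ((starRingEquiv : A ≃+* Aᵐᵒᵖ).symm : Aᵐᵒᵖ →+* A)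
    ((starRingEquiv : A ≃+* Aᵐᵒᵖ) : A →+* Aᵐᵒᵖ) :=
  RingHomInvPair.symm _ _

variable (A) in
/-- The involution, as a semilinear equivalence from the left regular module to the right
regular module. -/
def starEquiv : A ≃ₛₗ[((starRingEquiv : A ≃+* Aᵐᵒᵖ) : A →+* Aᵐᵒᵖ)] A where
  __ := (starAddEquiv : A ≃+ A)
  map_smul' c x := by simp [starRingEquiv]

@[simp] theorem starEquiv_apply (x : A) : starEquiv A x = star x := rfl

theorem map_starEquiv_leftIdeal (a : A) :
    (leftIdeal a).map (starEquiv A).toLinearMap = rightIdeal (star a) := by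
  ext x
  simp only [Submodule.mem_map, mem_rightIdeal, mem_leftIdeal]
  constructor
  · rintro ⟨_, ⟨b, rfl⟩, rfl⟩
    exact ⟨star b, by simp⟩
  · rintro ⟨b, rfl⟩
    exact ⟨star b * a, ⟨star b, rfl⟩, by simp⟩

theorem map_starEquiv_leftAnn (S : Set A) :
    (leftAnn S).map (starEquiv A).toLinearMap = rightAnn (star S) := by
  ext x
  constructor
  · rintro ⟨y, hy, rfl⟩ s hs
    have := congrArg star (hy (star s) hs)
    simpa using this
  · intro hx
    refine ⟨star x, fun s hs => ?_, by simp⟩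
    have := congrArg star (hx (star s) (by simpa using hs))
    simpa using this

theorem star_coe_leftIdeal (a : A) :
    star (leftIdeal a : Set A) = (rightIdeal (star a) : Set A) := by
  rw [← map_starEquiv_leftIdeal]
  ext x
  constructor
  · exact fun hx => ⟨star x, hx, star_star x⟩
  · rintro ⟨y, hy, rfl⟩
    simpa using hy

theorem star_coe_rightIdeal (a : A) :
    star (rightIdeal a : Set A) = (leftIdeal (star a) : Set A) := by
  rw [← star_star a, ← star_coe_leftIdeal, star_star, star_star]

/-- The involution induces a semilinear equivalence from `A / A a` to `A / a* A`. -/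
noncomputable def quotientStarEquiv (a : A) :
    (A ⧸ leftIdeal a) ≃ₛₗ[((starRingEquiv : A ≃+* Aᵐᵒᵖ) : A →+* Aᵐᵒᵖ)] (A ⧸ rightIdeal (star a)) :=
  Submodule.Quotient.equiv _ _ (starEquiv A) (map_starEquiv_leftIdeal a)

theorem isWeakMinusFredholm_iff_star (a : A) :
    IsWeakMinusFredholm a ↔ IsWeakPlusFredholm (star a) := by
  have := length_eq_of_semilinearEquiv (quotientStarEquiv (star a))
  rw [star_star] at this
  rw [IsWeakMinusFredholm, IsWeakPlusFredholm, xiL, xiR, this]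

theorem isSemisimpleModule_quotient_rightIdeal_iff_star (a : A) :
    IsSemisimpleModule Aᵐᵒᵖ (A ⧸ rightIdeal a) ↔
      IsSemisimpleModule A (A ⧸ leftIdeal (star a)) := by
  have := isSemisimpleModule_iff_of_semilinearEquiv (quotientStarEquiv (star a))
  rw [star_star] at this
  exact this.symm

theorem length_leftAnn (S : Set A) :
    Module.length A (leftAnn S) = Module.length Aᵐᵒᵖ (rightAnn (star S)) := by
  rw [← map_starEquiv_leftAnn]
  exact length_eq_of_semilinearEquiv ((starEquiv A).submoduleMap (leftAnn S))

theorem rhoR_eq_rhoL_star (a : A) : rhoR a = rhoL (star a) := by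
  rw [rhoR, rhoL, length_leftAnn, star_coe_rightIdeal]

end StarRing

/-! ### Socle and annihilators in a general ring -/

section Ring

variable {A : Type*} [Ring A]

theorem coe_leftAnn_singleton (p : A) : (leftAnn {p} : Set A) = {x | x * p = 0} := by
  ext x
  simp [leftAnn]

theorem mem_leftAnn_singleton {p x : A} : x ∈ leftAnn {p} ↔ x * p = 0 := by
  simp [leftAnn]

theorem mem_rightAnn_leftIdeal {a x : A} :
    x ∈ rightAnn (leftIdeal a : Set A) ↔ a * x = 0 := by
  constructor
  · exact fun h => h a (mem_leftIdeal.2 ⟨1, one_mul a⟩)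
  · rintro h s hs
    obtain ⟨b, rfl⟩ := mem_leftIdeal.1 hs
    rw [mul_assoc, h, mul_zero]

theorem isSemiPlusFredholm_iff {a : A} : IsSemiPlusFredholm a ↔ ∃ b, 1 - b * a ∈ socle A := by
  constructor
  · rintro ⟨b, hb⟩
    obtain ⟨b, rfl⟩ := Ideal.Quotient.mk_surjective b
    refine ⟨b, Ideal.Quotient.eq_zero_iff_mem.1 ?_⟩
    simp [hb]
  · rintro ⟨b, hb⟩
    refine ⟨Ideal.Quotient.mk _ b, ?_⟩
    have := Ideal.Quotient.eq_zero_iff_mem.2 hb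
    rw [map_sub, map_one, map_mul, sub_eq_zero] at this
    exact this.symm

theorem isSemiMinusFredholm_iff {a : A} : IsSemiMinusFredholm a ↔ ∃ b, 1 - a * b ∈ socle A := by
  constructor
  · rintro ⟨b, hb⟩
    obtain ⟨b, rfl⟩ := Ideal.Quotient.mk_surjective b
    refine ⟨b, Ideal.Quotient.eq_zero_iff_mem.1 ?_⟩
    simp [hb]
  · rintro ⟨b, hb⟩
    refine ⟨Ideal.Quotient.mk _ b, ?_⟩
    have := Ideal.Quotient.eq_zero_iff_mem.2 hb
    rw [map_sub, map_one, map_mul, sub_eq_zero] at this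
    exact this.symm

theorem isFredholm_iff (a : A) : IsFredholm a ↔ IsSemiPlusFredholm a ∧ IsSemiMinusFredholm a := by
  rw [IsFredholm, isUnit_iff_exists_and_exists]
  exact and_comm

instance : IsSemisimpleModule A (socle A) := by
  have h : socle A = ⨆ m ∈ {m : Ideal A | IsAtom m}, id m := sSup_eq_iSup
  rw [h]
  refine isSemisimpleModule_biSup_of_isSemisimpleModule_submodule fun m hm => ?_
  have : IsSimpleModule A m := isSimpleModule_iff_isAtom.2 hm
  exact inferInstanceAs (IsSemisimpleModule A m)

theorem IsSemiPlusFredholm.isSemisimpleModule {a : A} (h : IsSemiPlusFredholm a) :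
    IsSemisimpleModule A (A ⧸ leftIdeal a) := by
  obtain ⟨b, hb⟩ := isSemiPlusFredholm_iff.1 h
  refine IsSemisimpleModule.of_surjective
    ((leftIdeal a).mkQ ∘ₗ (socle A).subtype) fun y => ?_
  obtain ⟨x, rfl⟩ := (leftIdeal a).mkQ_surjective y
  -- Modulo `A a`, `x` equals `x (1 - b a)`, so the socle maps onto the quotient.
  refine ⟨⟨x * (1 - b * a), (socle A).mul_mem_left x hb⟩, ?_⟩
  have : x * (1 - b * a) - x ∈ leftIdeal a := mem_leftIdeal.2 ⟨-(x * b), by noncomm_ring⟩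
  exact (Submodule.Quotient.eq _).2 this

/-- The quotient is cyclic, and a finitely generated semisimple module has finite length. -/
theorem isWeakPlusFredholm_of_isSemisimpleModule {a : A}
    (h : IsSemisimpleModule A (A ⧸ leftIdeal a)) : IsWeakPlusFredholm a := by
  refine lt_top_iff_ne_top.2 (Module.length_ne_top_iff.2 ?_)
  exact isFiniteLength_iff_isNoetherian_isArtinian.2 ⟨inferInstance, inferInstance⟩

/-- A left ideal which is Artinian as a module lies in the socle as soon as all minimal left ideals
are complemented. -/
theorem le_socle_of_isArtinian (hc : ∀ m : Ideal A, IsAtom m → ∃ n, IsCompl m n)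
    (L : Ideal A) [IsArtinian A L] : L ≤ socle A := by
  have hwf : WellFounded fun K K' : Set.Iic L => K < K' :=
    (Submodule.mapIic L).symm.toOrderEmbedding.wellFounded (wellFounded_lt (α := Submodule A L))
  -- Take `K` minimal with `L ≤ K + soc(A)`. If `K ≠ 0`, it contains a minimal left ideal `m`; by
  -- modularity `K = m + (n ⊓ K)` for a complement `n` of `m`, and `n ⊓ K` contradicts minimality.
  obtain ⟨⟨K, hK⟩, hKL, hmin⟩ := hwf.has_min {K : Set.Iic L | L ≤ K.1 ⊔ socle A}
    ⟨⟨L, Set.self_mem_Iic⟩, (le_sup_left : L ≤ L ⊔ socle A)⟩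
  suffices K = ⊥ by simpa [this] using hKL
  by_contra hne
  have : IsAtomic (Set.Iic L) :=
    (OrderIso.isAtomic_iff (Submodule.mapIic L)).1 inferInstance
  obtain hbot | ⟨⟨m, hmL⟩, hm, hmK⟩ := eq_bot_or_exists_atom_le (⟨K, hK⟩ : Set.Iic L)
  · exact hne (congrArg Subtype.val hbot)
  replace hm : IsAtom m := IsAtom.of_isAtom_coe_Iic hm
  replace hmK : m ≤ K := hmK
  obtain ⟨n, hmn⟩ := hc m hm
  have hsup : m ⊔ n ⊓ K = K := by
    rw [← sup_inf_assoc_of_le n hmK, hmn.sup_eq_top, top_inf_eq]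
  refine hmin ⟨n ⊓ K, (inf_le_right.trans hK : n ⊓ K ≤ L)⟩ ?_ ?_
  · refine (show L ≤ K ⊔ socle A from hKL).trans (sup_le ?_ le_sup_right)
    nth_rewrite 1 [← hsup]
    exact sup_le ((le_sSup hm : m ≤ socle A).trans le_sup_right) le_sup_left
  · refine lt_of_le_of_ne (inf_le_right : n ⊓ K ≤ K) fun heq => hm.1 ?_
    have : K ≤ n := inf_eq_right.1 (congrArg Subtype.val heq)
    exact (hmn.disjoint.eq_bot_of_le (hmK.trans this))

theorem length_quotient_leftAnn_singleton (p : A) :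
    Module.length A (A ⧸ leftAnn {p}) = Module.length A (leftIdeal p) := by
  have hk : LinearMap.ker (LinearMap.toSpanSingleton A A p) = leftAnn {p} := by
    ext x
    simp [mem_leftAnn_singleton]
  rw [leftIdeal, ← LinearMap.range_toSpanSingleton, ← hk]
  exact (LinearMap.quotKerEquivRange _).length_eq

end Ring

/-! ### Minimal left ideals and the socle of a C*-algebra -/

section CStarAlgebra

variable {A : Type*} [CStarAlgebra A]

/-- For `0 ≠ x ∈ m` and `h = x* x`, the C*-identity gives `h² ≠ 0`, so `m = A h²` and `m` meets
`Lan(h)` trivially. Writing `z h = y h²` splits `z` as `y h + (z - y h)`. -/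
theorem exists_isCompl_of_isAtom {m : Ideal A} (hm : IsAtom m) : ∃ n, IsCompl m n := by
  obtain ⟨x, hxm, hx⟩ := Submodule.exists_mem_ne_zero_of_ne_bot hm.1
  set h := star x * x with hh
  have hsa : star h = h := by simp [hh]
  have hhm : h ∈ m := m.mul_mem_left _ hxm
  have h0 : h ≠ 0 := fun h => hx (CStarRing.star_mul_self_eq_zero_iff x |>.1 h)
  have hh0 : h * h ≠ 0 := fun h' => h0 <| by
    rwa [← CStarRing.star_mul_self_eq_zero_iff, hsa]
  have hinf : m ⊓ leftAnn {h} = ⊥ := by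
    refine (hm.le_iff.1 inf_le_left).resolve_right fun heq => ?_
    exact hh0 (mem_leftAnn_singleton.1 (inf_eq_left.1 heq hhm))
  have hspan : leftIdeal (h * h) = m := by
    refine (hm.le_iff.1 ?_).resolve_left fun heq => ?_
    · exact Submodule.span_le.2 (Set.singleton_subset_iff.2 (m.mul_mem_left _ hhm))
    · exact hh0 ((Submodule.span_singleton_eq_bot).1 heq)
  refine ⟨leftAnn {h}, disjoint_iff.2 hinf, codisjoint_iff.2 (eq_top_iff.2 fun z _ => ?_)⟩
  obtain ⟨y, hy⟩ := mem_leftIdeal.1 (hspan.symm ▸ m.mul_mem_left z hhm : z * h ∈ leftIdeal (h * h))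
  refine Submodule.mem_sup.2 ⟨y * h, m.mul_mem_left _ hhm, z - y * h, ?_, by abel⟩
  rw [mem_leftAnn_singleton, sub_mul, ← hy, ← mul_assoc, sub_self]

theorem star_mem_socle {s : A} (hs : s ∈ socle A) : star s ∈ socle A := by
  rw [socle, sSup_eq_iSup] at hs
  induction hs using Submodule.iSup_induction' with
  | zero => simp
  | add x y _ _ hx hy => simpa using add_mem hx hy
  | mem m x hx =>
    by_cases hm : IsAtom m
    swap
    · rw [iSup_neg (by exact hm)] at hx
      simp [(Submodule.mem_bot A).1 hx]
    replace hx : x ∈ m := by rwa [iSup_pos (by exact hm)] at hx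
    have hms : m ≤ socle A := le_sSup hm
    by_cases hx0 : x = 0
    · simp [hx0]
    have hspan : leftIdeal (star x * x) = m := by
      refine (hm.le_iff.1 ?_).resolve_left fun heq => ?_
      · exact Submodule.span_le.2 (Set.singleton_subset_iff.2 (m.mul_mem_left _ hx))
      · exact hx0 ((CStarRing.star_mul_self_eq_zero_iff x).1
          (Submodule.span_singleton_eq_bot.1 heq))
    -- From `x = y x* x` one gets `x* = x* x y*`, which is in the socle because the socle is
    -- two-sided.
    obtain ⟨y, hy⟩ := mem_leftIdeal.1 (hspan.symm ▸ hx : x ∈ leftIdeal (star x * x))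
    have : star x = star x * (x * star y) := by
      nth_rewrite 1 [← hy]
      simp [mul_assoc]
    rw [this]
    exact (socle A).mul_mem_left _ ((socle A).mul_mem_right _ (hms hx))

theorem isSemiMinusFredholm_iff_star (a : A) :
    IsSemiMinusFredholm a ↔ IsSemiPlusFredholm (star a) := by
  rw [isSemiMinusFredholm_iff, isSemiPlusFredholm_iff]
  constructor
  · rintro ⟨b, hb⟩
    exact ⟨star b, by simpa using star_mem_socle hb⟩
  · rintro ⟨b, hb⟩
    exact ⟨star b, by simpa using star_mem_socle hb⟩

/-! ### Consequences of a kernel projection -/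

/-- `a` has a left inverse modulo the projection onto its kernel. For C*-algebras this expresses
that `0` is not an accumulation point of the spectrum of `a* a`. -/
def HasKernelProjection (a : A) : Prop :=
  ∃ p : A, IsStarProjection p ∧ a * p = 0 ∧ ∃ b, b * a = 1 - p

theorem leftIdeal_eq_leftAnn {a p b : A} (hap : a * p = 0) (hba : b * a = 1 - p) :
    leftIdeal a = leftAnn {p} := by
  ext x
  rw [mem_leftIdeal, mem_leftAnn_singleton]
  constructor
  · rintro ⟨c, rfl⟩
    rw [mul_assoc, hap, mul_zero]
  · intro hx
    exact ⟨x * b, by rw [mul_assoc, hba, mul_sub, hx, mul_one, sub_zero]⟩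

theorem HasKernelProjection.isClosed {a : A} (h : HasKernelProjection a) :
    IsClosed (leftIdeal a : Set A) := by
  obtain ⟨p, -, hap, b, hba⟩ := h
  rw [leftIdeal_eq_leftAnn hap hba, coe_leftAnn_singleton]
  exact isClosed_eq (by fun_prop) (by fun_prop)

theorem HasKernelProjection.xiL_eq_rhoL {a : A} (h : HasKernelProjection a) : xiL a = rhoL a := by
  obtain ⟨p, hp, hap, b, hba⟩ := h
  have hr : rightAnn (leftIdeal a : Set A) = rightIdeal p := by
    ext x
    rw [mem_rightAnn_leftIdeal, mem_rightIdeal]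
    constructor
    · intro hx
      refine ⟨x, ?_⟩
      have : b * a * x = 0 := by rw [mul_assoc, hx, mul_zero]
      rw [hba, sub_mul, one_mul, sub_eq_zero] at this
      exact this.symm
    · rintro ⟨c, rfl⟩
      rw [← mul_assoc, hap, zero_mul]
  have hpp : star p = p := hp.isSelfAdjoint
  rw [xiL, rhoL, leftIdeal_eq_leftAnn hap hba, length_quotient_leftAnn_singleton,
    ← leftIdeal_eq_leftAnn hap hba, hr]
  have hmap := map_starEquiv_leftIdeal p
  rw [hpp] at hmap
  rw [← hmap]
  exact length_eq_of_semilinearEquiv ((starEquiv A).submoduleMap (leftIdeal p))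

theorem HasKernelProjection.isSemiPlusFredholm {a : A} (h : HasKernelProjection a)
    (hw : IsWeakPlusFredholm a) : IsSemiPlusFredholm a := by
  obtain ⟨p, -, hap, b, hba⟩ := h
  rw [IsWeakPlusFredholm, xiL, leftIdeal_eq_leftAnn hap hba,
    length_quotient_leftAnn_singleton, lt_top_iff_ne_top, Module.length_ne_top_iff,
    isFiniteLength_iff_isNoetherian_isArtinian] at hw
  have := hw.2
  refine isSemiPlusFredholm_iff.2 ⟨b, ?_⟩
  rw [hba, sub_sub_cancel]
  exact le_socle_of_isArtinian (fun m hm => exists_isCompl_of_isAtom hm) (leftIdeal p)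
    (mem_leftIdeal.2 ⟨1, one_mul p⟩)

/-! ### The spectral gap at zero -/

theorem nonneg_of_mem_spectrum_star_mul_self {a : A} {t : ℝ} (ht : t ∈ spectrum ℝ (star a * a)) :
    0 ≤ t := by
  let _ := CStarAlgebra.spectralOrder A
  have := CStarAlgebra.spectralOrderedRing A
  exact spectrum_nonneg_of_nonneg (star_mul_self_nonneg a) ht

/-- With `F = y G + z a`, one has `F² ≤ 2 (‖y‖² G² + ‖z‖² a* a)`; both sides are functions of `a*
a`, so the inequality can be read pointwise on the spectrum. -/
theorem cfc_star_mul_self_bound {a y z : A} {f g : ℝ → ℝ} (hf : Continuous f) (hg : Continuous g)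
    (h : cfc f (star a * a) = y * cfc g (star a * a) + z * a) :
    ∃ C : ℝ, ∀ t ∈ spectrum ℝ (star a * a), f t ^ 2 ≤ C * (g t ^ 2 + t) := by
  let _ := CStarAlgebra.spectralOrder A
  have := CStarAlgebra.spectralOrderedRing A
  have hsa : IsSelfAdjoint (star a * a) := .star_mul_self a
  set k := star a * a with hk
  set F := cfc f k with hF
  set G := cfc g k with hG
  have hFs : star F = F := (cfc_predicate f k : IsSelfAdjoint _)
  have hGs : star G = G := (cfc_predicate g k : IsSelfAdjoint _)
  have hconj (w c : A) : star (w * c) * (w * c) ≤ (‖w‖ ^ 2) • (star c * c) := by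
    have := star_left_conjugate_le_conjugate
      (CStarAlgebra.star_mul_le_algebraMap_norm_sq (a := w)) c
    rw [Algebra.algebraMap_eq_smul_one] at this
    simpa [mul_assoc] using this
  have hpar (u v : A) : star (u + v) * (u + v) ≤ (2 : ℝ) • (star u * u + star v * v) := by
    have h1 : (2 : ℝ) • (star u * u + star v * v) - star (u + v) * (u + v)
        = star (u - v) * (u - v) := by
      rw [two_smul, star_add, star_sub]
      noncomm_ring
    rw [← sub_nonneg, h1]
    exact star_mul_self_nonneg _
  have key : F * F ≤ (2 : ℝ) • ((‖y‖ ^ 2) • (G * G) + (‖z‖ ^ 2) • k) := by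
    calc F * F = star F * F := by rw [hFs]
      _ ≤ (2 : ℝ) • (star (y * G) * (y * G) + star (z * a) * (z * a)) := by
        rw [h]; exact hpar _ _
      _ ≤ _ := by
        refine smul_le_smul_of_nonneg_left (add_le_add ?_ (hconj z a)) two_pos.le
        simpa [hGs] using hconj y G
  have hL : F * F = cfc (fun t => f t * f t) k := (cfc_mul f f k).symm
  have hR : (2 : ℝ) • ((‖y‖ ^ 2) • (G * G) + (‖z‖ ^ 2) • k)
      = cfc (fun t => 2 * (‖y‖ ^ 2 * (g t * g t) + ‖z‖ ^ 2 * t)) k := by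
    rw [cfc_const_mul _ _ k (by fun_prop), cfc_add k _ _ (by fun_prop) (by fun_prop),
      cfc_const_mul _ _ k (by fun_prop), cfc_const_mul _ _ k (by fun_prop), cfc_mul g g k,
      cfc_id' ℝ k]
  rw [hL, hR, cfc_le_iff _ _ k (by fun_prop) (by fun_prop)] at key
  refine ⟨2 * (‖y‖ ^ 2 + ‖z‖ ^ 2), fun t ht => (by simpa [sq] using key t ht : f t ^ 2 ≤ _).trans ?_⟩
  have ht0 := nonneg_of_mem_spectrum_star_mul_self ht
  nlinarith [mul_nonneg (sq_nonneg ‖y‖) ht0, mul_nonneg (sq_nonneg ‖z‖) (sq_nonneg (g t))]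

/-- For `0 < t < 1`, `4β ≤ 1` gives `t ≤ t^(4β)`, so the bound becomes `1 ≤ 2|C| t^(2β)`, which
fails near `0`. -/
theorem eventually_eq_zero_of_rpow_bound {s : Set ℝ} (hs : ∀ t ∈ s, 0 ≤ t) {β C : ℝ} (hβ : 0 < β)
    (hβ' : β ≤ 1 / 4) (h : ∀ t ∈ s, (t ^ β) ^ 2 ≤ C * ((t ^ (2 * β)) ^ 2 + t)) :
    ∀ᶠ t in 𝓝[s] 0, t = 0 := by
  have hlim : Tendsto (fun t : ℝ => 2 * |C| * t ^ (2 * β)) (𝓝 0) (𝓝 0) := by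
    have : Continuous fun t : ℝ => 2 * |C| * t ^ (2 * β) :=
      continuous_const.mul (Real.continuous_rpow_const (by positivity))
    simpa [Real.zero_rpow (by positivity : 2 * β ≠ 0)] using this.tendsto 0
  filter_upwards [self_mem_nhdsWithin, nhdsWithin_le_nhds (hlim.eventually_lt_const one_pos),
    nhdsWithin_le_nhds (eventually_lt_nhds (one_pos : (0 : ℝ) < 1))] with t hts ht ht1
  by_contra hne
  have htpos : 0 < t := lt_of_le_of_ne (hs t hts) (Ne.symm hne)
  have hb := h t hts
  have e1 : (t ^ β) ^ 2 = t ^ (2 * β) := by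
    rw [← Real.rpow_natCast, ← Real.rpow_mul htpos.le]
    congr 1
    push_cast
    ring
  have e2 : t ≤ (t ^ (2 * β)) ^ 2 := by
    rw [← Real.rpow_natCast, ← Real.rpow_mul htpos.le]
    nth_rewrite 1 [← Real.rpow_one t]
    refine Real.rpow_le_rpow_of_exponent_ge htpos ht1.le ?_
    push_cast
    linarith
  rw [e1] at hb
  have hx : 0 < t ^ (2 * β) := Real.rpow_pos_of_pos htpos _
  have h3 : C * ((t ^ (2 * β)) ^ 2 + t) ≤ |C| * ((t ^ (2 * β)) ^ 2 + (t ^ (2 * β)) ^ 2) :=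
    mul_le_mul (le_abs_self C) (by linarith) (by positivity) (abs_nonneg C)
  nlinarith [mul_lt_mul_of_pos_right ht hx]

theorem hasKernelProjection_of_eventually {a : A}
    (h : ∀ᶠ t in 𝓝[spectrum ℝ (star a * a)] 0, t = 0) : HasKernelProjection a := by
  have hsa : IsSelfAdjoint (star a * a) := .star_mul_self a
  set k := star a * a with hk
  -- The gap makes inversion, with `0⁻¹ = 0`, continuous on the spectrum. Hence `q = k⁻¹ k` is the
  -- support projection of `k`, and `1 - q` is the kernel projection.
  have hc : ContinuousOn (fun t : ℝ => t⁻¹) (spectrum ℝ k) := by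
    intro t ht
    by_cases h0 : t = 0
    · subst h0
      refine ContinuousWithinAt.congr_of_eventuallyEq continuousWithinAt_const
        (h.mono fun t ht => ?_) rfl
      rw [ht]
    · exact (continuousAt_inv₀ h0).continuousWithinAt
  have hm : cfc (fun t : ℝ => t⁻¹) k * k = cfc (fun t : ℝ => t⁻¹ * t) k := by
    rw [cfc_mul _ _ k hc (by fun_prop), cfc_id' ℝ k]
  have hcq : ContinuousOn (fun t : ℝ => t⁻¹ * t) (spectrum ℝ k) := hc.mul continuousOn_id
  set q := cfc (fun t : ℝ => t⁻¹ * t) k with hq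
  have hqq : q * q = q := by
    rw [hq, ← cfc_mul _ _ k hcq hcq]
    refine cfc_congr fun t _ => ?_
    rcases eq_or_ne t 0 with rfl | h0
    · simp
    · simp [h0]
  have hkq : k * q = k := by
    have hid : cfc (fun t : ℝ => t) k = k := cfc_id' ℝ k
    refine Eq.trans ?_ hid
    nth_rewrite 1 [← hid]
    rw [hq, ← cfc_mul _ _ k (by fun_prop) hcq]
    refine cfc_congr fun t _ => ?_
    rcases eq_or_ne t 0 with rfl | h0
    · simp
    · simp [h0]
  have hqs : IsStarProjection q := ⟨hqq, cfc_predicate _ _⟩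
  refine ⟨1 - q, hqs.one_sub, ?_, cfc (fun t : ℝ => t⁻¹) k * star a, ?_⟩
  · rw [← CStarRing.star_mul_self_eq_zero_iff, star_mul, mul_assoc, ← mul_assoc (star a), ← hk,
      mul_sub, mul_one, hkq, sub_self, mul_zero]
  · rw [mul_assoc, ← hk, hm, sub_sub_cancel]

theorem hasKernelProjection_of_cfc_rpow_eq {a y z : A} {β : ℝ} (hβ : 0 < β) (hβ' : β ≤ 1 / 4)
    (h : cfc (fun t : ℝ => t ^ β) (star a * a)
      = y * cfc (fun t : ℝ => t ^ (2 * β)) (star a * a) + z * a) : HasKernelProjection a := by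
  obtain ⟨C, hC⟩ := cfc_star_mul_self_bound (Real.continuous_rpow_const hβ.le)
    (Real.continuous_rpow_const (by positivity)) h
  exact hasKernelProjection_of_eventually (eventually_eq_zero_of_rpow_bound
    (fun t ht => nonneg_of_mem_spectrum_star_mul_self ht) hβ hβ' hC)

/-- `L ∩ L*` is a closed non-unital star subalgebra containing `k`. The non-unital calculus is
essential, since `L` need not contain `1`. -/
theorem cfcₙ_mem_of_isClosed {L : Ideal A} (hL : IsClosed (L : Set A)) {k : A}
    (hk : IsSelfAdjoint k) (hkL : k ∈ L) (f : ℝ → ℝ) : cfcₙ f k ∈ L := by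
  let S : NonUnitalStarSubalgebra ℝ A :=
    { carrier := {x | x ∈ L ∧ star x ∈ L}
      zero_mem' := by simp
      add_mem' := fun hx hy => ⟨add_mem hx.1 hy.1, by simpa using add_mem hx.2 hy.2⟩
      mul_mem' := fun hx hy => ⟨L.mul_mem_left _ hy.1, by simpa using L.mul_mem_left _ hx.2⟩
      smul_mem' := fun c x hx => by
        constructor
        · rw [Algebra.smul_def]
          exact L.mul_mem_left _ hx.1
        · rw [star_smul, star_trivial, Algebra.smul_def]
          exact L.mul_mem_left _ hx.2
      star_mem' := fun hx => ⟨hx.2, by simpa using hx.1⟩ }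
  have hS : IsClosed (S : Set A) := hL.inter (hL.preimage continuous_star)
  have hkS : k ∈ S := ⟨hkL, by rwa [hk.star_eq]⟩
  exact (NonUnitalStarAlgebra.elemental.le_of_mem hS hkS (cfcₙ_mem_elemental f k)).1

theorem hasKernelProjection_of_isClosed {a : A} (h : IsClosed (leftIdeal a : Set A)) :
    HasKernelProjection a := by
  have hmem := cfcₙ_mem_of_isClosed h (.star_mul_self a) (mem_leftIdeal.2 ⟨star a, rfl⟩)
    (fun t : ℝ => t ^ (1 / 4 : ℝ))
  rw [cfcₙ_eq_cfc (Real.continuous_rpow_const (by norm_num)).continuousOn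
    (Real.zero_rpow (by norm_num))] at hmem
  obtain ⟨z, hz⟩ := mem_leftIdeal.1 hmem
  exact hasKernelProjection_of_cfc_rpow_eq (y := 0) (z := z) (by norm_num) le_rfl
    (by rw [zero_mul, zero_add, hz])

theorem IsWeakPlusFredholm.hasKernelProjection {a : A} (h : IsWeakPlusFredholm a) :
    HasKernelProjection a := by
  rw [IsWeakPlusFredholm, xiL, lt_top_iff_ne_top, Module.length_ne_top_iff,
    isFiniteLength_iff_isNoetherian_isArtinian] at h
  have := h.1
  -- Halving exponents gives `K n = K (n + 1)²`, so the classes of the `K n` generate an increasing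
  -- chain in the Noetherian quotient; the shift by `2` keeps every exponent at most `1/4`.
  set β : ℕ → ℝ := fun n => (1 / 2 : ℝ) ^ (n + 2) with hβ
  have hβpos (n) : 0 < β n := by positivity
  have hβsucc (n) : β n = 2 * β (n + 1) := by simp only [hβ]; ring
  set K : ℕ → A := fun n => cfc (fun t : ℝ => t ^ β n) (star a * a) with hK
  have hKsucc (n) : K n = K (n + 1) * K (n + 1) := by
    have hc : Continuous fun t : ℝ => t ^ β (n + 1) := Real.continuous_rpow_const (hβpos _).le
    simp only [hK]
    rw [← cfc_mul _ _ _ hc.continuousOn hc.continuousOn]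
    refine cfc_congr fun t ht => ?_
    have ht0 := nonneg_of_mem_spectrum_star_mul_self ht
    change t ^ β n = _
    rw [hβsucc, two_mul, Real.rpow_add_of_nonneg ht0 (hβpos _).le (hβpos _).le]
  let N : ℕ →o Submodule A (A ⧸ leftIdeal a) :=
    ⟨fun n => Submodule.span A {(leftIdeal a).mkQ (K n)}, monotone_nat_of_le_succ fun n => by
      rw [Submodule.span_singleton_le_iff_mem, hKsucc n]
      exact (Submodule.span A {(leftIdeal a).mkQ (K (n + 1))}).smul_mem (K (n + 1))
        (Submodule.mem_span_singleton_self _)⟩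
  obtain ⟨n, hn⟩ := monotone_stabilizes_iff_noetherian.2 h.1 N
  have hmem : (leftIdeal a).mkQ (K (n + 1)) ∈ N n := by
    rw [hn (n + 1) n.le_succ]
    exact Submodule.mem_span_singleton_self _
  obtain ⟨y, hy⟩ := Submodule.mem_span_singleton.1 hmem
  rw [← map_smul] at hy
  obtain ⟨z, hz⟩ := mem_leftIdeal.1 ((Submodule.Quotient.eq _).1 hy.symm)
  refine hasKernelProjection_of_cfc_rpow_eq (y := y) (z := z) (hβpos (n + 1)) ?_ ?_
  · simp only [hβ]
    calc (1 / 2 : ℝ) ^ (n + 1 + 2) ≤ (1 / 2 : ℝ) ^ 2 :=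
          pow_le_pow_of_le_one (by norm_num) (by norm_num) (by omega)
      _ = 1 / 4 := by norm_num
  · rw [← hβsucc, hz]
    simp [hK]

/-! ### The equivalences -/

theorem plusFredholm_tfae (a : A) :
    List.TFAE
      [IsWeakPlusFredholm a, IsSemiPlusFredholm a, IsSemisimpleModule A (A ⧸ leftIdeal a),
        rhoL a < ⊤ ∧ IsClosed (leftIdeal a : Set A)] := by
  tfae_have 1 → 2 := fun h => h.hasKernelProjection.isSemiPlusFredholm h
  tfae_have 2 → 3 := IsSemiPlusFredholm.isSemisimpleModule
  tfae_have 3 → 1 := isWeakPlusFredholm_of_isSemisimpleModule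
  tfae_have 1 → 4 := fun h =>
    ⟨h.hasKernelProjection.xiL_eq_rhoL ▸ h, h.hasKernelProjection.isClosed⟩
  tfae_have 4 → 1 := fun h => by
    rw [IsWeakPlusFredholm, (hasKernelProjection_of_isClosed h.2).xiL_eq_rhoL]
    exact h.1
  tfae_finish

theorem isClosed_rightIdeal_iff_star (a : A) :
    IsClosed (rightIdeal a : Set A) ↔ IsClosed (leftIdeal (star a) : Set A) := by
  rw [← star_coe_rightIdeal]
  constructor
  · exact fun h => h.preimage continuous_star
  · intro h
    simpa using h.preimage (continuous_star (R := A))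

theorem minusFredholm_tfae (a : A) :
    List.TFAE
      [IsWeakMinusFredholm a, IsSemiMinusFredholm a, IsSemisimpleModule Aᵐᵒᵖ (A ⧸ rightIdeal a),
        rhoR a < ⊤ ∧ IsClosed (rightIdeal a : Set A)] := by
  rw [isWeakMinusFredholm_iff_star, isSemiMinusFredholm_iff_star,
    isSemisimpleModule_quotient_rightIdeal_iff_star, rhoR_eq_rhoL_star,
    isClosed_rightIdeal_iff_star]
  exact plusFredholm_tfae (star a)

end CStarAlgebra

end FredholmLength

theorem mainTheorem1 {A : Type*} [CStarAlgebra A] (a : A) :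
    List.TFAE
      [FredholmLength.IsWeakPlusFredholm a,
        FredholmLength.IsSemiPlusFredholm a,
        IsSemisimpleModule A (A ⧸ FredholmLength.leftIdeal a),
        FredholmLength.rhoL a < ⊤ ∧ IsClosed (FredholmLength.leftIdeal a : Set A)] ∧
    List.TFAE
      [FredholmLength.IsWeakMinusFredholm a,
        FredholmLength.IsSemiMinusFredholm a,
        IsSemisimpleModule Aᵐᵒᵖ (A ⧸ FredholmLength.rightIdeal a),
        FredholmLength.rhoR a < ⊤ ∧ IsClosed (FredholmLength.rightIdeal a : Set A)] ∧
    (FredholmLength.IsFredholm a ↔ FredholmLength.IsWeakFredholm a) := by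
  refine ⟨FredholmLength.plusFredholm_tfae a, FredholmLength.minusFredholm_tfae a, ?_⟩
  rw [FredholmLength.isFredholm_iff]
  exact and_congr ((FredholmLength.plusFredholm_tfae a).out 1 0)
    ((FredholmLength.minusFredholm_tfae a).out 1 0)
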